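/- Let $G=(V,E)$ be a finite simple graph and let $m\ge 0$ be an integer. A system of polynomials $f_1,\dots,f_s$ over $\mathbb{C}$ is infeasible if it has no common zero over $\mathbb{C}$. A Nullstellensatz certificate for it is a tuple of polynomials $(\beta_1,\dots,\beta_s)$, in the same variables and with coefficients in $\mathbb{C}$, such that $\sum_i\beta_if_i=1$; its degree is $\max_i\deg\beta_i$. A subgraph $H$ of $G$ cages a vertex $v$ of $G$ if every edge of $G$ incident to $v$ is an edge of $H$. **Part 1.** $G$ has a vertex cover of size $m$ if and only if the following system, with one variable $x_i$ for each $i\in V$, has a solution over $\mathbb{C}$: $$-m+\sum_{i\in V}x_i=0,\qquad x_i^2-x_i=0\ \ (i\in V),\qquad (x_i-1)(x_j-1)=0\ \ (\{i,j\}\in E).$$ If the system is infeasible, then the minimum degree of a Nullstellensatz certificate for it is equal to the independence number $\alpha(G)$. **Part 2.** $G$ has an edge cover of size $m$ (a set of $m$ edges such that every vertex is incident to at least one of them) if and only if the following system, with one variable $x_e$ for each $e\in E$, has a solution over $\mathbb{C}$: $$-m+\sum_{e\in E}x_e=0,\qquad x_e^2-x_e=0\ \ (e\in E),\qquad \prod_{e\ni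 i}(x_e-1)=0\ \ (i\in V).$$ If the system is infeasible, then the minimum degree of a Nullstellensatz certificate for it is equal to the maximum number of edges of a subgraph of $G$ that cages no vertex of $G$. (If $G$ has an isolated vertex, every subgraph cages that vertex, and the maximum over the empty set is read as $0$.) -/

import Mathlib

/-- The polynomial system `f i = 0` (`i : ι`) has a common zero over `ℂ`. -/
def PolySystem.IsFeasible {σ ι : Type*} (f : ι → MvPolynomial σ ℂ) : Prop :=
  ∃ a : σ → ℂ, ∀ i, MvPolynomial.eval a (f i) = 0

/-- `β` is a Nullstellensatz certificate for the system `f`. -/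
def PolySystem.IsNullstellensatzCert {σ ι : Type*} [Fintype ι]
    (f β : ι → MvPolynomial σ ℂ) : Prop :=
  ∑ i, β i * f i = 1

/-- The degree of a certificate: the maximum of the total degrees of its members. -/
noncomputable def PolySystem.certDegree {σ ι : Type*} [Fintype ι]
    (β : ι → MvPolynomial σ ℂ) : ℕ :=
  Finset.univ.sup fun i => (β i).totalDegree

/-- `d` is the degree of a minimum degree Nullstellensatz certificate for `f`
(in particular, such a certificate exists). -/
def PolySystem.IsMinCertDegree {σ ι : Type*} [Fintype ι]
    (f : ι → MvPolynomial σ ℂ) (d : ℕ) : Prop :=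
  IsLeast {k | ∃ β : ι → MvPolynomial σ ℂ,
    PolySystem.IsNullstellensatzCert f β ∧ PolySystem.certDegree β = k} d

namespace SimpleGraph

/-- The system for a vertex cover of size `m`, with one variable per vertex:
`-m + ∑ x_i`, `x_i ^ 2 - x_i` for each vertex `i`,
and `(x_i - 1) (x_j - 1)` for each edge `{i, j}`. -/
noncomputable def vertexCoverSystem {V : Type*} [Fintype V] (G : SimpleGraph V) (m : ℕ) :
    Unit ⊕ V ⊕ G.edgeSet → MvPolynomial V ℂ
  | .inl _ => -(m : MvPolynomial V ℂ) + ∑ i : V, MvPolynomial.X i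
  | .inr (.inl i) => MvPolynomial.X i ^ 2 - MvPolynomial.X i
  | .inr (.inr e) =>
      Sym2.lift ⟨fun i j : V => ((MvPolynomial.X i - 1) * (MvPolynomial.X j - 1) :
        MvPolynomial V ℂ), fun _ _ => mul_comm _ _⟩ (e : Sym2 V)

/-- The system for an edge cover of size `m`, with one variable per edge:
`-m + ∑ x_e`, `x_e ^ 2 - x_e` for each edge `e`,
and `∏ (x_e - 1)`, over the edges `e` incident to `i`, for each vertex `i`. -/
noncomputable def edgeCoverSystem {V : Type*} [DecidableEq V] (G : SimpleGraph V)
    [Fintype G.edgeSet] (m : ℕ) :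
    Unit ⊕ G.edgeSet ⊕ V → MvPolynomial G.edgeSet ℂ
  | .inl _ => -(m : MvPolynomial G.edgeSet ℂ) + ∑ e : G.edgeSet, MvPolynomial.X e
  | .inr (.inl e) => MvPolynomial.X e ^ 2 - MvPolynomial.X e
  | .inr (.inr i) =>
      ∏ e ∈ Finset.univ.filter (fun e : G.edgeSet => i ∈ (e : Sym2 V)), (MvPolynomial.X e - 1)

/-- `C` is an edge cover of `G`: a set of edges of `G` such that every vertex is incident
to one of them. -/
def IsEdgeCover {V : Type*} (G : SimpleGraph V) (C : Set (Sym2 V)) : Prop :=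
  C ⊆ G.edgeSet ∧ ∀ v : V, ∃ e ∈ C, v ∈ e

/-- The subgraph `H` of `G` cages the vertex `v` of `G`: every edge of `G` incident to `v`
is an edge of `H`. -/
def Subgraph.Cages {V : Type*} {G : SimpleGraph V} (H : G.Subgraph) (v : V) : Prop :=
  G.incidenceSet v ⊆ H.edgeSet

/-- The set of the numbers of edges of the subgraphs of `G` that cage no vertex of `G`. -/
def uncagingSizes {V : Type*} (G : SimpleGraph V) : Set ℕ :=
  {k | ∃ H : G.Subgraph, (∀ v : V, ¬ H.Cages v) ∧ H.edgeSet.ncard = k}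

/-- The maximum number of edges of a subgraph of the finite graph `G` that cages no vertex
of `G`. If `G` has an isolated vertex, every subgraph cages it, and the maximum over the
empty set is `0`; see `isGreatest_maxUncagingSize` and `maxUncagingSize_of_isolated`. -/
noncomputable def maxUncagingSize {V : Type*} (G : SimpleGraph V) : ℕ :=
  sSup G.uncagingSizes

theorem isGreatest_maxUncagingSize {V : Type*} [Finite V] (G : SimpleGraph V)
    (hG : ∀ v : V, ∃ w, G.Adj v w) : IsGreatest G.uncagingSizes G.maxUncagingSize := by
  have hne : G.uncagingSizes.Nonempty := by
    refine ⟨_, ⊥, fun v hv => ?_, rfl⟩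
    obtain ⟨w, hw⟩ := hG v
    have := hv (show s(v, w) ∈ G.incidenceSet v from ⟨hw, Sym2.mem_mk_left v w⟩)
    simp at this
  have hbdd : BddAbove G.uncagingSizes := by
    refine ⟨G.edgeSet.ncard, ?_⟩
    rintro k ⟨H, -, rfl⟩
    exact Set.ncard_le_ncard H.edgeSet_subset (Set.toFinite _)
  exact ⟨Nat.sSup_mem hne hbdd, fun k hk => le_csSup hbdd hk⟩

theorem maxUncagingSize_of_isolated {V : Type*} (G : SimpleGraph V) (v : V)
    (hv : ∀ w, ¬ G.Adj v w) : G.uncagingSizes = ∅ ∧ G.maxUncagingSize = 0 := by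
  have h : G.uncagingSizes = ∅ := by
    refine Set.eq_empty_of_forall_notMem ?_
    rintro k ⟨H, hH, -⟩
    refine hH v fun e he => ?_
    obtain ⟨he1, he2⟩ := he
    obtain ⟨w, rfl⟩ := Sym2.mem_iff_exists.mp he2
    exact absurd he1 (hv w)
  exact ⟨h, by simp [maxUncagingSize, h]⟩

end SimpleGraph

/-!
Both systems are instances of one: for a family `F` of subsets of a finite set `σ` and a number
`m`, `hittingSystem F m` says that `x ∈ {0, 1}^σ` is the indicator of a set of size `m` that meets
every `F k`. In the variables `y_i = 1 - x_i` it says that `y` is the indicator of a *face*, a set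
containing no `F k`, and that `∑ y_i = c`, where `c = |σ| - m`. The faces form a simplicial complex;
for vertex covers they are the independent sets, for edge covers the edge sets that cage no vertex.

Modulo the other equations, a certificate has to invert `c - ∑ y_i`, so its first member takes the
value `1 / (c - |T|)` at the indicator of each face `T`.

* Lower bound. For a face `S`, the alternating sum over the subsets `T` of `S` of the values of
  a polynomial of degree less than `|S|` is zero (`sum_powerset_eval_eq_zero`), but
  `∑ (-1)^|T| / (c - |T|) = (-1)^|S| |S|! / ∏_{j ≤ |S|} (c - j)` is not (`sum_powerset_inv`). Hence
  no certificate has degree less than the size of a face.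
* Upper bound. The inverse is `∑_S a_|S| y^S` over the faces `S`, with
  `a_k = k! / ∏_{j ≤ k} (c - j)`. Expanding `(c - ∑ y_i) ∑_S a_|S| y^S` produces products
  `y_i y^S`, and rewriting each to `y^S`, `y^(S ∪ {i})` or `0` uses multiples of the other
  generators with multipliers of degree at most `|S|` (`inverse_mul_sub_one_mem`).

No denominator vanishes: there are faces of every size up to the largest, and a face of size `c`
would be the complement of a solution.
-/

open MvPolynomial

namespace PolySystem

/-! ### Hitting systems -/

section Hitting

variable {σ κ : Type*}

/-- The system whose solutions are the indicators of the sets of size `m` that meet every `F k`: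
`-m + ∑ x_i`, `x_i ^ 2 - x_i` for each `i`, and `∏ (x_i - 1)`, over `i ∈ F k`, for each `k`. -/
noncomputable def hittingSystem [Fintype σ] (F : κ → Finset σ) (m : ℕ) :
    Unit ⊕ σ ⊕ κ → MvPolynomial σ ℂ
  | .inl _ => -(m : MvPolynomial σ ℂ) + ∑ i : σ, X i
  | .inr (.inl i) => X i ^ 2 - X i
  | .inr (.inr k) => ∏ i ∈ F k, (X i - 1)

/-- A face of the simplicial complex whose non-faces are generated by the family `F`: a set
that contains no member of the family. -/
def IsFace (F : κ → Finset σ) (S : Finset σ) : Prop := ∀ k, ¬ F k ⊆ S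

theorem IsFace.mono {F : κ → Finset σ} {S T : Finset σ} (hS : IsFace F S) (h : T ⊆ S) :
    IsFace F T := fun k hk => hS k (hk.trans h)

/-- The zero-one point attached to `T`: zero on `T` and one off `T`. -/
def zeroOn [DecidableEq σ] (T : Finset σ) : σ → ℂ := fun i => if i ∈ T then 0 else 1

theorem sum_zeroOn [Fintype σ] [DecidableEq σ]
    (T : Finset σ) : ∑ i, zeroOn T i = (Fintype.card σ : ℂ) - T.card := by
  have h : ∀ i, zeroOn T i = 1 - if i ∈ T then 1 else 0 := by
    intro i; unfold zeroOn; split_ifs <;> simp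
  simp [h, Finset.sum_sub_distrib]

theorem eval_hittingSystem_sum [Fintype σ] [DecidableEq σ]
    (F : κ → Finset σ) (m : ℕ) (T : Finset σ) :
    eval (zeroOn T) (hittingSystem F m (.inl ())) = (Fintype.card σ : ℂ) - m - T.card := by
  simp only [hittingSystem, map_add, map_neg, map_natCast, map_sum, eval_X, sum_zeroOn]
  ring

theorem IsFace.eval_hittingSystem_inr [Fintype σ] [DecidableEq σ]
    {F : κ → Finset σ} {T : Finset σ} (hT : IsFace F T)
    (m : ℕ) (j : σ ⊕ κ) : eval (zeroOn T) (hittingSystem F m (.inr j)) = 0 := by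
  rcases j with i | k
  · simp only [hittingSystem, map_sub, map_pow, eval_X, zeroOn]
    split_ifs <;> simp
  · obtain ⟨i, hi, hiT⟩ := Finset.not_subset.1 (hT k)
    simp only [hittingSystem, map_prod, map_sub, eval_X, map_one]
    exact Finset.prod_eq_zero hi (by simp [zeroOn, hiT])

theorem isFeasible_hittingSystem_iff_isFace [Fintype σ] [DecidableEq σ]
    (F : κ → Finset σ) (m : ℕ) :
    IsFeasible (hittingSystem F m) ↔
      ∃ T, IsFace F T ∧ (Fintype.card σ : ℂ) - m = T.card := by
  constructor
  · rintro ⟨a, ha⟩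
    have h01 : ∀ i, a i = 0 ∨ a i = 1 := by
      intro i
      have h := ha (.inr (.inl i))
      simp only [hittingSystem, map_sub, map_pow, eval_X] at h
      have h' : a i * (a i - 1) = 0 := by rw [← h]; ring
      exact (mul_eq_zero.1 h').imp_right sub_eq_zero.1
    obtain ⟨T, hT⟩ : ∃ T : Finset σ, ∀ i, i ∈ T ↔ a i = 0 :=
      ⟨Finset.univ.filter fun i => a i = 0, by simp⟩
    have haT : a = zeroOn T := by
      funext i
      rcases h01 i with h | h <;> simp [zeroOn, hT, h]
    refine ⟨T, fun k hk => ?_, ?_⟩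
    · have h := ha (.inr (.inr k))
      simp only [hittingSystem, map_prod, map_sub, eval_X, map_one] at h
      obtain ⟨i, hi, h⟩ := Finset.prod_eq_zero_iff.1 h
      have h0 := (hT i).1 (hk hi)
      simp [h0] at h
    · have h := ha (.inl ())
      rw [haT, eval_hittingSystem_sum] at h
      exact sub_eq_zero.1 h
  · rintro ⟨T, hT, h⟩
    refine ⟨zeroOn T, fun j => ?_⟩
    rcases j with ⟨⟩ | j
    · rw [eval_hittingSystem_sum, h, sub_self]
    · exact hT.eval_hittingSystem_inr m j

theorem isFeasible_hittingSystem_iff [Fintype σ] [DecidableEq σ]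
    (F : κ → Finset σ) (m : ℕ) :
    IsFeasible (hittingSystem F m) ↔
      ∃ C : Finset σ, (∀ k, ∃ i ∈ F k, i ∈ C) ∧ C.card = m := by
  rw [isFeasible_hittingSystem_iff_isFace]
  constructor
  · rintro ⟨T, hT, h⟩
    refine ⟨Tᶜ, fun k => ?_, ?_⟩
    · obtain ⟨i, hi, hiT⟩ := Finset.not_subset.1 (hT k)
      exact ⟨i, hi, Finset.mem_compl.2 hiT⟩
    · have h' : (Fintype.card σ : ℂ) = (T.card + m : ℕ) := by
        push_cast; rw [← h]; ring
      have h'' : Fintype.card σ = T.card + m := by exact_mod_cast h'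
      rw [Finset.card_compl]; omega
  · rintro ⟨C, hC, rfl⟩
    refine ⟨Cᶜ, fun k hk => ?_, ?_⟩
    · obtain ⟨i, hi, hiC⟩ := hC k
      exact Finset.mem_compl.1 (hk hi) hiC
    · rw [Finset.card_compl, Nat.cast_sub (Finset.card_le_univ C)]

/-! ### Lower bound: alternating sums over the subsets of a face -/

/-- A monomial of degree less than `|S|` misses some variable of `S`, and toggling membership of
that variable cancels the terms of the alternating sum in pairs. -/
theorem sum_powerset_eval_eq_zero [Fintype σ] [DecidableEq σ]
    (p : MvPolynomial σ ℂ) (S : Finset σ)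
    (hp : p.totalDegree < S.card) :
    ∑ T ∈ S.powerset, (-1 : ℂ) ^ T.card * eval (zeroOn T) p = 0 := by
  simp only [eval_eq', Finset.mul_sum]
  rw [Finset.sum_comm]
  refine Finset.sum_eq_zero fun d hd => ?_
  obtain ⟨i, hiS, hi⟩ : ∃ i ∈ S, d i = 0 := by
    by_contra! h
    have h1 : S.card ≤ ∑ i ∈ S, d i := by
      rw [Finset.card_eq_sum_ones]
      exact Finset.sum_le_sum fun i hi => Nat.one_le_iff_ne_zero.2 (h i hi)
    have h2 : ∑ i ∈ S, d i ≤ ∑ i, d i :=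
      Finset.sum_le_sum_of_subset (Finset.subset_univ S)
    have h3 := le_totalDegree hd
    rw [Finsupp.sum_fintype _ _ (fun _ => rfl)] at h3
    omega
  have key : ∀ T ∈ S.powerset, (-1 : ℂ) ^ T.card * (coeff d p * ∏ j, zeroOn T j ^ d j) =
      coeff d p * ((∏ j ∈ T, -(0 : ℂ) ^ d j) * ∏ j ∈ S \ T, 1) := by
    intro T _
    have h : ∏ j, zeroOn T j ^ d j = ∏ j ∈ T, (0 : ℂ) ^ d j := by
      rw [← Finset.prod_subset (Finset.subset_univ T)]
      · exact Finset.prod_congr rfl fun j hj => by simp [zeroOn, hj]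
      · intro j _ hj; simp [zeroOn, hj]
    rw [h, Finset.prod_neg]
    simp only [Finset.prod_const_one]
    ring
  rw [Finset.sum_congr rfl key, ← Finset.mul_sum, ← Finset.prod_add,
    Finset.prod_eq_zero hiS (by simp [hi]), mul_zero]

/-- The iterated finite difference of `1 / c`. -/
theorem sum_powerset_inv [DecidableEq σ]
    (S : Finset σ) (c : ℂ) (hc : ∀ k ≤ S.card, c ≠ k) :
    ∑ T ∈ S.powerset, (-1 : ℂ) ^ T.card * (c - T.card)⁻¹ =
      (-1) ^ S.card * S.card.factorial * (∏ j ∈ Finset.range (S.card + 1), (c - j))⁻¹ := by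
  induction S using Finset.induction_on generalizing c with
  | empty => simp
  | insert a S ha ih =>
    rw [Finset.card_insert_of_notMem ha] at hc ⊢
    have h1 : ∀ T ∈ S.powerset, (-1 : ℂ) ^ (insert a T).card * (c - (insert a T).card)⁻¹ =
        -((-1 : ℂ) ^ T.card * ((c - 1) - T.card)⁻¹) := by
      intro T hT
      rw [Finset.card_insert_of_notMem fun h => ha (Finset.mem_powerset.1 hT h)]
      push_cast
      rw [pow_succ, sub_sub, add_comm (1 : ℂ)]
      ring
    rw [Finset.sum_powerset_insert ha, Finset.sum_congr rfl h1, Finset.sum_neg_distrib,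
      ih c fun k hk => hc k (by omega), ih (c - 1) ?_]
    · -- Both products share the factors `c - 1, …, c - |S|`.
      have h2 : ∏ j ∈ Finset.range (S.card + 1), (c - 1 - j) =
          (∏ j ∈ Finset.range S.card, (c - 1 - j)) * (c - (S.card + 1 : ℕ)) := by
        rw [Finset.prod_range_succ]; push_cast; ring
      have h3 : ∏ j ∈ Finset.range (S.card + 1), (c - j) =
          c * ∏ j ∈ Finset.range S.card, (c - 1 - j) := by
        rw [Finset.prod_range_succ', mul_comm]
        simp [sub_sub, add_comm]
      have h4 : ∏ j ∈ Finset.range S.card, (c - 1 - j) ≠ 0 := by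
        refine Finset.prod_ne_zero_iff.2 fun j hj h => ?_
        refine hc (j + 1) (by have := Finset.mem_range.1 hj; omega) ?_
        push_cast; linear_combination h
      have h5 : c - (S.card + 1 : ℕ) ≠ 0 := sub_ne_zero.2 (hc _ le_rfl)
      have h6 : c ≠ 0 := by simpa using hc 0 (by omega)
      rw [Finset.prod_range_succ (fun j : ℕ => c - (j : ℂ)) (S.card + 1), h3, h2,
        Nat.factorial_succ]
      generalize ∏ j ∈ Finset.range S.card, (c - 1 - (j : ℂ)) = Q at *
      push_cast at h5 ⊢
      field_simp
      ring
    · intro k hk h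
      refine hc (k + 1) (by omega) ?_
      push_cast; linear_combination h

theorem IsFace.card_le_certDegree [Fintype σ] [DecidableEq σ]
    [Fintype κ] {F : κ → Finset σ} {m : ℕ} {S : Finset σ}
    (hS : IsFace F S) (hinf : ¬ IsFeasible (hittingSystem F m))
    {β : Unit ⊕ σ ⊕ κ → MvPolynomial σ ℂ} (hβ : IsNullstellensatzCert (hittingSystem F m) β) :
    S.card ≤ certDegree β := by
  set c : ℂ := (Fintype.card σ : ℂ) - m with hc
  have hne : ∀ T, IsFace F T → c ≠ T.card := fun T hT h =>
    hinf ((isFeasible_hittingSystem_iff_isFace F m).2 ⟨T, hT, h⟩)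
  have hval : ∀ T, IsFace F T → eval (zeroOn T) (β (.inl ())) = (c - T.card)⁻¹ := by
    intro T hT
    have h := congrArg (eval (zeroOn T)) hβ
    rw [Fintype.sum_sum_type] at h
    simp only [map_add, map_sum, map_mul, hT.eval_hittingSystem_inr, mul_zero,
      Finset.sum_const_zero, add_zero, Finset.univ_unique, Finset.sum_singleton, map_one] at h
    exact eq_inv_of_mul_eq_one_left ((eval_hittingSystem_sum F m T) ▸ h)
  refine le_trans ?_ (Finset.le_sup (f := fun i => (β i).totalDegree)
    (Finset.mem_univ (Sum.inl ())))
  by_contra! hlt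
  have h0 := sum_powerset_eval_eq_zero _ S hlt
  have hcS : ∀ k ≤ S.card, c ≠ k := by
    intro k hk
    obtain ⟨T, hT, rfl⟩ := Finset.exists_subset_card_eq hk
    exact hne T (hS.mono hT)
  rw [Finset.sum_congr rfl fun T hT => by rw [hval T (hS.mono (Finset.mem_powerset.1 hT))],
    sum_powerset_inv S c hcS] at h0
  refine absurd h0 (mul_ne_zero (mul_ne_zero (by simp) ?_) (inv_ne_zero ?_))
  · exact_mod_cast S.card.factorial_ne_zero
  · exact Finset.prod_ne_zero_iff.2 fun j hj =>
      sub_ne_zero.2 (hcS j (Nat.lt_succ_iff.1 (Finset.mem_range.1 hj)))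

/-! ### Upper bound: the inverse of `c - ∑ y_i` on the complex of faces -/

/-- The polynomials `∑ β_j f_j` with multipliers `β_j` of total degree at most `D`. -/
def boundedSpan {ι : Type*} [Fintype ι] (f : ι → MvPolynomial σ ℂ) (D : ℕ) :
    Submodule ℂ (MvPolynomial σ ℂ) where
  carrier := {p | ∃ β : ι → MvPolynomial σ ℂ, (∀ j, (β j).totalDegree ≤ D) ∧ ∑ j, β j * f j = p}
  zero_mem' := ⟨0, by simp, by simp⟩
  add_mem' := by
    rintro _ _ ⟨β, hβ, rfl⟩ ⟨γ, hγ, rfl⟩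
    exact ⟨β + γ, fun j => (totalDegree_add _ _).trans (max_le (hβ j) (hγ j)),
      by simp [add_mul, Finset.sum_add_distrib]⟩
  smul_mem' := by
    rintro a _ ⟨β, hβ, rfl⟩
    exact ⟨a • β, fun j => (totalDegree_smul_le _ _).trans (hβ j), by simp [Finset.smul_sum]⟩

theorem mul_mem_boundedSpan {ι : Type*} [Fintype ι] [DecidableEq ι] {f : ι → MvPolynomial σ ℂ}
    {D : ℕ} {p : MvPolynomial σ ℂ} (hp : p.totalDegree ≤ D) (j : ι) :
    p * f j ∈ boundedSpan f D := by
  refine ⟨Pi.single j p, fun i => ?_, ?_⟩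
  · by_cases h : i = j
    · subst h; simpa using hp
    · simp [h]
  · rw [Finset.sum_eq_single j (fun i _ h => by simp [h]) (by simp)]; simp

/-- The monomial `y^S` in the variables `y_i = 1 - x_i`. -/
noncomputable def flipMonomial (S : Finset σ) : MvPolynomial σ ℂ := ∏ i ∈ S, (1 - X i)

theorem totalDegree_flipMonomial_le (S : Finset σ) : (flipMonomial S).totalDegree ≤ S.card := by
  refine (totalDegree_finsetProd _ _).trans ?_
  rw [Finset.card_eq_sum_ones]
  refine Finset.sum_le_sum fun i _ => (totalDegree_sub _ _).trans ?_
  simp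

theorem mul_flipMonomial_sub_self_mem [Fintype σ] [DecidableEq σ] [Fintype κ] [DecidableEq κ]
    (F : κ → Finset σ) (m : ℕ) {D : ℕ} {S : Finset σ}
    (hS : S.card ≤ D) {i : σ} (hi : i ∈ S) :
    (1 - X i) * flipMonomial S - flipMonomial S ∈
      boundedSpan (fun j => hittingSystem F m (.inr j)) D := by
  have h : (1 - X i) * flipMonomial S - flipMonomial S =
      flipMonomial (S.erase i) * hittingSystem F m (.inr (.inl i)) := by
    rw [flipMonomial, ← Finset.mul_prod_erase S _ hi]
    simp only [hittingSystem, flipMonomial]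
    ring
  rw [h]
  exact mul_mem_boundedSpan (f := fun j => hittingSystem F m (.inr j))
    ((totalDegree_flipMonomial_le _).trans ((Finset.card_erase_le).trans hS)) (.inl i)

/-- If `S` is a face and `S ∪ {i}` is not, then `S ∪ {i}` contains some `F k`, which is nonempty
because `S` is a face; this is why the multiplier of `∏ (x_j - 1)` has degree at most `|S|`. -/
theorem mul_flipMonomial_mem [Fintype σ] [DecidableEq σ] [Fintype κ] [DecidableEq κ]
    {F : κ → Finset σ} (m : ℕ) {D : ℕ} {S : Finset σ}
    (hF : IsFace F S) (hS : S.card ≤ D) {i : σ} (hi : i ∉ S) (hn : ¬ IsFace F (insert i S)) :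
    (1 - X i) * flipMonomial S ∈ boundedSpan (fun j => hittingSystem F m (.inr j)) D := by
  obtain ⟨k, hk⟩ : ∃ k, F k ⊆ insert i S := by simpa [IsFace] using hn
  have hpos : 0 < (F k).card := Finset.card_pos.2 (Finset.nonempty_iff_ne_empty.2 fun h =>
    hF k (h ▸ Finset.empty_subset S))
  have hcard : (insert i S \ F k).card ≤ D := by
    rw [Finset.card_sdiff_of_subset hk, Finset.card_insert_of_notMem hi]; omega
  have hneg : (flipMonomial (F k) : MvPolynomial σ ℂ) =
      (-1) ^ (F k).card * hittingSystem F m (.inr (.inr k)) := by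
    simp only [hittingSystem, flipMonomial]
    rw [← Finset.prod_neg]
    exact Finset.prod_congr rfl fun j _ => by ring
  have h : (1 - X i) * flipMonomial S = ((-1 : ℂ) ^ (F k).card) •
      (flipMonomial (insert i S \ F k) * hittingSystem F m (.inr (.inr k))) := by
    have hsplit : (1 - X i) * flipMonomial S =
        (flipMonomial (insert i S \ F k) * flipMonomial (F k) : MvPolynomial σ ℂ) := by
      simp only [flipMonomial]
      rw [Finset.prod_sdiff hk, Finset.prod_insert hi]
    rw [hsplit, hneg, smul_eq_C_mul]
    simp only [map_pow, map_neg, map_one]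
    ring
  rw [h]
  exact Submodule.smul_mem _ _ (mul_mem_boundedSpan
    (f := fun j => hittingSystem F m (.inr j)) ((totalDegree_flipMonomial_le _).trans hcard)
    (.inr k))

/-- The coefficient `k! / ∏_{j ≤ k} (c - j)` of the faces of size `k` in the inverse of
`c - ∑ y_i`, in the form of the recursion that it satisfies. -/
noncomputable def inverseCoeff (c : ℂ) : ℕ → ℂ
  | 0 => c⁻¹
  | k + 1 => (k + 1) * inverseCoeff c k / (c - (k + 1))

open Classical in
/-- The inverse of `c - ∑ y_i` modulo the remaining equations: the combination of the
monomials `y^S` of the faces `S` with coefficients `inverseCoeff c |S|`. -/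
noncomputable def faceInverse [Fintype σ] (F : κ → Finset σ) (c : ℂ) : MvPolynomial σ ℂ :=
  ∑ S : Finset σ with IsFace F S, inverseCoeff c S.card • flipMonomial S

open Classical in
/-- Collecting the terms that raise the degree: each face `S` arises from its `|S|` facets. -/
theorem sum_face_insert [Fintype σ]
    (F : κ → Finset σ) (a : ℕ → ℂ) :
    ∑ S : Finset σ with IsFace F S, ∑ i : σ with i ∉ S ∧ IsFace F (insert i S),
        a S.card • flipMonomial (insert i S) =
      ∑ S : Finset σ with IsFace F S, (S.card * a (S.card - 1)) • flipMonomial S := by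
  have h : ∀ S : Finset σ, (S.card * a (S.card - 1)) • flipMonomial S =
      ∑ _i ∈ S, a (S.card - 1) • flipMonomial S := by
    intro S
    rw [Finset.sum_const, ← Nat.cast_smul_eq_nsmul ℂ, smul_smul]
  simp only [h]
  rw [Finset.sum_sigma', Finset.sum_sigma']
  refine Finset.sum_bij' (fun x _ => ⟨insert x.2 x.1, x.2⟩) (fun x _ => ⟨x.1.erase x.2, x.2⟩)
    ?_ ?_ ?_ ?_ ?_
  · rintro ⟨S, i⟩ hx
    simp only [Finset.mem_sigma, Finset.mem_filter, Finset.mem_univ, true_and] at hx ⊢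
    exact ⟨hx.2.2, Finset.mem_insert_self _ _⟩
  · rintro ⟨S, i⟩ hx
    simp only [Finset.mem_sigma, Finset.mem_filter, Finset.mem_univ, true_and] at hx ⊢
    exact ⟨hx.1.mono (Finset.erase_subset _ _), Finset.notMem_erase _ _,
      by rw [Finset.insert_erase hx.2]; exact hx.1⟩
  · rintro ⟨S, i⟩ hx
    simp only [Finset.mem_sigma, Finset.mem_filter, Finset.mem_univ, true_and] at hx
    simp [Finset.erase_insert hx.2.1]
  · rintro ⟨S, i⟩ hx
    simp only [Finset.mem_sigma] at hx
    simp [Finset.insert_erase hx.2]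
  · rintro ⟨S, i⟩ hx
    simp only [Finset.mem_sigma, Finset.mem_filter, Finset.mem_univ, true_and] at hx
    simp [Finset.card_insert_of_notMem hx.2.1]

open Classical in
theorem inverse_mul_sub_one_mem [Fintype σ] [Fintype κ]
    {F : κ → Finset σ} {m D : ℕ} (hF : IsFace F ∅)
    (hD : ∀ S, IsFace F S → S.card ≤ D)
    (hc : ∀ S, IsFace F S → (Fintype.card σ : ℂ) - m ≠ S.card) :
    faceInverse F ((Fintype.card σ : ℂ) - m) * hittingSystem F m (.inl ()) - 1 ∈
      boundedSpan (fun j => hittingSystem F m (.inr j)) D := by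
  set c : ℂ := (Fintype.card σ : ℂ) - m with hcdef
  set M := boundedSpan (fun j => hittingSystem F m (.inr j)) D with hM
  have hL : hittingSystem F m (.inl ()) = C c - ∑ i : σ, (1 - X i) := by
    simp [hittingSystem, hcdef, Finset.sum_sub_distrib]
    ring
  -- The face `S` contributes `(c - |S|) y^S - ∑ y^(S ∪ {i})` modulo the other generators.
  have hstep : ∀ S, IsFace F S →
      flipMonomial S * hittingSystem F m (.inl ()) -
        ((c - S.card) • flipMonomial S -
          ∑ i : σ with i ∉ S ∧ IsFace F (insert i S), flipMonomial (insert i S)) ∈ M := by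
    intro S hS
    have hterm : ∀ i : σ, (1 - X i) * flipMonomial S -
        ((if i ∈ S then flipMonomial S else 0) +
          if i ∉ S ∧ IsFace F (insert i S) then flipMonomial (insert i S) else 0) ∈ M := by
      intro i
      by_cases hi : i ∈ S
      · simpa [hi] using mul_flipMonomial_sub_self_mem F m (hD S hS) hi
      · by_cases hn : IsFace F (insert i S)
        · have : (1 - X i) * flipMonomial S - flipMonomial (insert i S) = 0 := by
            simp [flipMonomial, Finset.prod_insert hi]
          simp [hi, hn, this]
        · simpa [hi, hn] using mul_flipMonomial_mem m hS (hD S hS) hi hn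
    have hsum := M.neg_mem (M.sum_mem (t := Finset.univ) fun i _ => hterm i)
    convert hsum using 1
    rw [Finset.sum_sub_distrib, Finset.sum_add_distrib, ← Finset.sum_filter, ← Finset.sum_filter,
      ← Finset.sum_mul, Finset.filter_mem_eq_inter, Finset.univ_inter, Finset.sum_const, hL,
      sub_smul, Nat.cast_smul_eq_nsmul, smul_eq_C_mul]
    ring
  have htot := M.sum_mem (t := Finset.univ.filter fun S => IsFace F S) fun S hS =>
    M.smul_mem (inverseCoeff c S.card) (hstep S (Finset.mem_filter.1 hS).2)
  -- By the recursion for `inverseCoeff`, only the empty face survives.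
  have hone : ∑ S : Finset σ with IsFace F S, inverseCoeff c S.card •
      ((c - S.card) • flipMonomial S -
        ∑ i : σ with i ∉ S ∧ IsFace F (insert i S), flipMonomial (insert i S)) = 1 := by
    simp only [smul_sub, Finset.smul_sum, Finset.sum_sub_distrib]
    rw [sum_face_insert, ← Finset.sum_sub_distrib, Finset.sum_eq_single ∅]
    · have h0 : c ≠ 0 := by simpa using hc ∅ hF
      simp [flipMonomial, inverseCoeff, smul_smul, h0]
    · intro S hS hne
      obtain ⟨k, hk⟩ := Nat.exists_eq_succ_of_ne_zero (Finset.card_ne_zero.2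
        (Finset.nonempty_iff_ne_empty.2 hne))
      have h1 := sub_ne_zero.2 (hc S (Finset.mem_filter.1 hS).2)
      rw [hk] at h1 ⊢
      rw [smul_smul, ← sub_smul]
      convert zero_smul ℂ _
      simp only [Nat.succ_eq_add_one, inverseCoeff, Nat.add_sub_cancel] at h1 ⊢
      push_cast at h1 ⊢
      field_simp
      ring
    · intro h; exact absurd (Finset.mem_filter.2 ⟨Finset.mem_univ _, hF⟩) h
  simp only [smul_sub (inverseCoeff _ _) (flipMonomial _ * _) _] at htot
  rw [Finset.sum_sub_distrib, hone] at htot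
  simpa only [faceInverse, Finset.sum_mul, smul_mul_assoc] using htot

open Classical in
theorem totalDegree_faceInverse_le [Fintype σ]
    {F : κ → Finset σ} {D : ℕ}
    (hD : ∀ S, IsFace F S → S.card ≤ D) (c : ℂ) : (faceInverse F c).totalDegree ≤ D :=
  totalDegree_finsetSum_le fun S hS => (totalDegree_smul_le _ _).trans
    ((totalDegree_flipMonomial_le S).trans (hD S (Finset.mem_filter.1 hS).2))

open Classical in
theorem exists_cert_of_isFace_empty [Fintype σ] [Fintype κ]
    {F : κ → Finset σ} {m D : ℕ} (hF : IsFace F ∅)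
    (hD : ∀ S, IsFace F S → S.card ≤ D) (hinf : ¬ IsFeasible (hittingSystem F m)) :
    ∃ β, IsNullstellensatzCert (hittingSystem F m) β ∧ certDegree β ≤ D := by
  obtain ⟨β, hβ, hsum⟩ := inverse_mul_sub_one_mem (m := m) hF hD fun S hS h =>
    hinf ((isFeasible_hittingSystem_iff_isFace F m).2 ⟨S, hS, h⟩)
  refine ⟨Sum.elim (fun _ => faceInverse F ((Fintype.card σ : ℂ) - m)) (-β), ?_, ?_⟩
  · rw [IsNullstellensatzCert, Fintype.sum_sum_type]
    simp only [Finset.univ_unique, Finset.sum_singleton, Sum.elim_inl, Sum.elim_inr, Pi.neg_apply,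
      neg_mul, Finset.sum_neg_distrib]
    rw [hsum, PUnit.default_eq_unit]
    ring
  · refine Finset.sup_le fun j _ => ?_
    rcases j with j | j
    · exact totalDegree_faceInverse_le hD _
    · simpa using hβ j

open Classical in
/-- The second alternative in `hmax` is the case of an empty complex, in which some `F k` is empty
and the corresponding equation reads `1 = 0`. -/
theorem isMinCertDegree_hittingSystem [Fintype σ] [Fintype κ]
    {F : κ → Finset σ} {m D : ℕ}
    (hD : ∀ S, IsFace F S → S.card ≤ D)
    (hmax : (∃ S, IsFace F S ∧ S.card = D) ∨ ¬ IsFace F ∅ ∧ D = 0)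
    (hinf : ¬ IsFeasible (hittingSystem F m)) :
    IsMinCertDegree (hittingSystem F m) D := by
  have hlow : ∀ β, IsNullstellensatzCert (hittingSystem F m) β → D ≤ certDegree β := by
    intro β hβ
    rcases hmax with ⟨S, hS, rfl⟩ | ⟨-, rfl⟩
    · exact hS.card_le_certDegree hinf hβ
    · exact Nat.zero_le _
  obtain ⟨β, hβ, hdeg⟩ :
      ∃ β, IsNullstellensatzCert (hittingSystem F m) β ∧ certDegree β ≤ D := by
    by_cases hF : IsFace F ∅
    · exact exists_cert_of_isFace_empty hF hD hinf
    · obtain ⟨k, hk⟩ : ∃ k, F k = ∅ := by simpa [IsFace] using hF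
      refine ⟨Pi.single (.inr (.inr k)) 1, ?_, Finset.sup_le fun j _ => ?_⟩
      · rw [IsNullstellensatzCert, Finset.sum_eq_single (.inr (.inr k))
          (fun j _ h => by simp [h]) (by simp)]
        simp [hittingSystem, hk]
      · rw [Pi.single_apply]; split_ifs <;> simp
  refine ⟨⟨β, hβ, le_antisymm hdeg (hlow β hβ)⟩, ?_⟩
  rintro _ ⟨γ, hγ, rfl⟩
  exact hlow γ hγ

end Hitting

end PolySystem

open PolySystem

namespace SimpleGraph

variable {V : Type*} (G : SimpleGraph V)

/-! ### Vertex covers -/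

section VertexCover

variable [Fintype V] [DecidableEq V]

/-- The endpoints of each edge: the sets that a vertex cover has to meet. -/
def edgeEnds (e : G.edgeSet) : Finset V := Finset.univ.filter (· ∈ (e : Sym2 V))

theorem vertexCoverSystem_eq_hittingSystem (m : ℕ) :
    G.vertexCoverSystem m = hittingSystem G.edgeEnds m := by
  funext j
  rcases j with _ | i | ⟨e, he⟩
  · rfl
  · rfl
  · induction e using Sym2.ind with
    | _ a b =>
      have hab : a ≠ b := G.ne_of_adj he
      have h : G.edgeEnds ⟨s(a, b), he⟩ = {a, b} := by ext; simp [edgeEnds]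
      simp only [hittingSystem, h, Finset.prod_pair hab]
      rfl

theorem isFace_edgeEnds_iff (S : Finset V) :
    IsFace G.edgeEnds S ↔ G.IsIndepSet (S : Set V) := by
  constructor
  · intro h a ha b hb _ hadj
    refine h ⟨s(a, b), hadj⟩ fun x hx => ?_
    rcases (by simpa [edgeEnds] using hx : x = a ∨ x = b) with rfl | rfl
    exacts [ha, hb]
  · rintro h ⟨e, he⟩ hk
    induction e using Sym2.ind with
    | _ a b =>
      exact h (hk (by simp [edgeEnds])) (hk (by simp [edgeEnds])) (G.ne_of_adj he) he

theorem isVertexCover_iff_meets (C : Finset V) :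
    G.IsVertexCover (C : Set V) ↔ ∀ e, ∃ i ∈ G.edgeEnds e, i ∈ C := by
  constructor
  · rintro h ⟨e, he⟩
    induction e using Sym2.ind with
    | _ a b =>
      rcases h he with h | h
      exacts [⟨a, by simp [edgeEnds], h⟩, ⟨b, by simp [edgeEnds], h⟩]
  · intro h a b hab
    obtain ⟨i, hi, hiC⟩ := h ⟨s(a, b), hab⟩
    rcases (by simpa [edgeEnds] using hi : i = a ∨ i = b) with rfl | rfl
    exacts [Or.inl hiC, Or.inr hiC]

end VertexCover

/-! ### Edge covers -/

theorem ncard_edgeSet_eq_card (H : G.Subgraph) (S : Finset G.edgeSet)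
    (hS : ∀ e : G.edgeSet, e ∈ S ↔ (e : Sym2 V) ∈ H.edgeSet) : H.edgeSet.ncard = S.card := by
  have h : H.edgeSet = (S.map (Function.Embedding.subtype _) : Finset (Sym2 V)) := by
    ext e
    simp only [Finset.coe_map, Function.Embedding.coe_subtype, Set.mem_image, Finset.mem_coe,
      Subtype.exists, exists_and_right, exists_eq_right]
    exact ⟨fun he => ⟨H.edgeSet_subset he, (hS ⟨e, _⟩).2 he⟩, fun ⟨h, he⟩ => (hS ⟨e, h⟩).1 he⟩
  rw [h, Set.ncard_coe_finset, Finset.card_map]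

/-- The spanning subgraph with a given set of edges. -/
def spanningSubgraph (S : Finset G.edgeSet) : G.Subgraph where
  verts := Set.univ
  Adj a b := ∃ h : G.Adj a b, (⟨s(a, b), h⟩ : G.edgeSet) ∈ S
  adj_sub h := h.1
  edge_vert _ := Set.mem_univ _
  symm := ⟨fun a b ⟨h, hS⟩ => ⟨h.symm, by simpa only [Sym2.eq_swap] using hS⟩⟩

theorem mem_spanningSubgraph (S : Finset G.edgeSet) (e : G.edgeSet) :
    e ∈ S ↔ (e : Sym2 V) ∈ (G.spanningSubgraph S).edgeSet := by
  obtain ⟨e, he⟩ := e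
  induction e using Sym2.ind with
  | _ a b => exact ⟨fun h => ⟨he, h⟩, fun ⟨_, h⟩ => h⟩

section EdgeCover

variable [Fintype V] [DecidableEq V] [DecidableRel G.Adj]

/-- The edges at each vertex: the sets that an edge cover has to meet. -/
def vertexStar (v : V) : Finset G.edgeSet := Finset.univ.filter fun e => v ∈ (e : Sym2 V)

theorem edgeCoverSystem_eq_hittingSystem (m : ℕ) :
    G.edgeCoverSystem m = hittingSystem G.vertexStar m := by
  funext j
  rcases j with _ | _ | _ <;> rfl

theorem exists_isEdgeCover_iff (m : ℕ) :
    (∃ C : Finset (Sym2 V), G.IsEdgeCover (C : Set (Sym2 V)) ∧ C.card = m) ↔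
      ∃ C : Finset G.edgeSet, (∀ v, ∃ e ∈ G.vertexStar v, e ∈ C) ∧ C.card = m := by
  constructor
  · rintro ⟨C, ⟨hC, hcov⟩, rfl⟩
    refine ⟨C.subtype (· ∈ G.edgeSet), fun v => ?_, ?_⟩
    · obtain ⟨e, he, hv⟩ := hcov v
      exact ⟨⟨e, hC he⟩, by simpa [vertexStar] using hv, by simpa using he⟩
    · rw [Finset.card_subtype, Finset.filter_true_of_mem fun e he => hC he]
  · rintro ⟨C, hC, rfl⟩
    refine ⟨C.map (Function.Embedding.subtype _), ⟨?_, fun v => ?_⟩, Finset.card_map _⟩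
    · intro e he
      obtain ⟨e', -, rfl⟩ := Finset.mem_map.1 he
      exact e'.2
    · obtain ⟨e, hev, he⟩ := hC v
      exact ⟨e, Finset.mem_map_of_mem _ he, by simpa [vertexStar] using hev⟩

theorem cages_iff_vertexStar_subset (H : G.Subgraph) (S : Finset G.edgeSet)
    (hS : ∀ e : G.edgeSet, e ∈ S ↔ (e : Sym2 V) ∈ H.edgeSet) (v : V) :
    H.Cages v ↔ G.vertexStar v ⊆ S := by
  constructor
  · intro h e he
    exact (hS e).2 (h ⟨e.2, by simpa [vertexStar] using he⟩)
  · intro h e he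
    exact (hS ⟨e, he.1⟩).1 (h (by simpa [vertexStar] using he.2))

theorem mem_uncagingSizes_iff (k : ℕ) :
    k ∈ G.uncagingSizes ↔ ∃ S, IsFace G.vertexStar S ∧ S.card = k := by
  classical
  constructor
  · rintro ⟨H, hH, rfl⟩
    have hS : ∀ e : G.edgeSet, e ∈ (Finset.univ.filter fun e : G.edgeSet =>
        (e : Sym2 V) ∈ H.edgeSet) ↔ (e : Sym2 V) ∈ H.edgeSet := by simp
    exact ⟨_, fun v hv => hH v ((G.cages_iff_vertexStar_subset H _ hS v).2 hv),
      (G.ncard_edgeSet_eq_card H _ hS).symm⟩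
  · rintro ⟨S, hS, rfl⟩
    have hmem := G.mem_spanningSubgraph S
    exact ⟨_, fun v hv => hS v ((G.cages_iff_vertexStar_subset _ S hmem v).1 hv),
      G.ncard_edgeSet_eq_card _ S hmem⟩

theorem isFace_card_le_maxUncagingSize (S : Finset G.edgeSet) (hS : IsFace G.vertexStar S) :
    S.card ≤ G.maxUncagingSize := by
  refine le_csSup ⟨Fintype.card G.edgeSet, fun k hk => ?_⟩
    ((G.mem_uncagingSizes_iff _).2 ⟨S, hS, rfl⟩)
  obtain ⟨T, -, rfl⟩ := (G.mem_uncagingSizes_iff k).1 hk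
  exact Finset.card_le_univ T

theorem exists_isFace_card_eq_maxUncagingSize :
    (∃ S, IsFace G.vertexStar S ∧ S.card = G.maxUncagingSize) ∨
      ¬ IsFace G.vertexStar ∅ ∧ G.maxUncagingSize = 0 := by
  by_cases hG : ∀ v : V, ∃ w, G.Adj v w
  · exact Or.inl ((G.mem_uncagingSizes_iff _).1 (G.isGreatest_maxUncagingSize hG).1)
  · push Not at hG
    obtain ⟨v, hv⟩ := hG
    obtain ⟨hempty, h0⟩ := G.maxUncagingSize_of_isolated v hv
    refine Or.inr ⟨fun h => ?_, h0⟩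
    have := (G.mem_uncagingSizes_iff 0).2 ⟨∅, h, rfl⟩
    simp [hempty] at this

end EdgeCover

end SimpleGraph

theorem mainTheorem7 {V : Type*} [Fintype V] [DecidableEq V] (G : SimpleGraph V)
    [DecidableRel G.Adj] (m : ℕ) :
    (((∃ C : Finset V, G.IsVertexCover (C : Set V) ∧ C.card = m) ↔
        PolySystem.IsFeasible (G.vertexCoverSystem m)) ∧
      (¬ PolySystem.IsFeasible (G.vertexCoverSystem m) →
        PolySystem.IsMinCertDegree (G.vertexCoverSystem m) G.indepNum)) ∧
    (((∃ C : Finset (Sym2 V), G.IsEdgeCover (C : Set (Sym2 V)) ∧ C.card = m) ↔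
        PolySystem.IsFeasible (G.edgeCoverSystem m)) ∧
      (¬ PolySystem.IsFeasible (G.edgeCoverSystem m) →
        PolySystem.IsMinCertDegree (G.edgeCoverSystem m) G.maxUncagingSize)) := by
  rw [G.vertexCoverSystem_eq_hittingSystem, G.edgeCoverSystem_eq_hittingSystem]
  refine ⟨⟨?_, isMinCertDegree_hittingSystem (fun S hS => ?_) (Or.inl ?_)⟩, ?_,
    isMinCertDegree_hittingSystem G.isFace_card_le_maxUncagingSize
      G.exists_isFace_card_eq_maxUncagingSize⟩
  · simp only [isFeasible_hittingSystem_iff, G.isVertexCover_iff_meets]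
  · exact ((G.isFace_edgeEnds_iff S).1 hS).card_le_indepNum
  · obtain ⟨S, hS⟩ := G.exists_isNIndepSet_indepNum
    exact ⟨S, (G.isFace_edgeEnds_iff S).2 hS.isIndepSet, hS.card_eq⟩
  · rw [isFeasible_hittingSystem_iff, G.exists_isEdgeCover_iff]
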